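/- Let $k\ge 0$ and let $X=\mathrm{Tot}(\mathcal O_{\mathbb P^1}(-k))$, a toric surface with charts $(z,u)$ and $(z^{-1},z^ku)$ and with torus coordinates $t_1=z$, $t_2=u$. Then $X$ belongs to a self-dual toric Landau–Ginzburg model $(X,W,K)$, whose superpotential $W=a_0t_2+a_1t_1t_2+\dots+a_kt_1^kt_2$ ($a_i\in\mathbb C$) is determined by a global section of $\mathcal O_{\mathbb P^1}(k)$, if and only if $k=2$. Here the terms are used as follows. For a toric variety $X$ with character lattice $M$ and dual lattice $N$, let $R$ be the set of torus-invariant prime divisors and $\mathrm{dv}\colon M\to\mathbb Z^R$, $\chi\mapsto(\mathrm{ord}_D\chi)_D$. A toric Landau–Ginzburg model $(X,W,K)$ consists of $X$, a regular function $W=\sum_{\xi\in\Xi}a_\xi\xi$ on $X$ (with $\Xi\subset M$ finite and all $a_\xi\ne0$), and a class $K\in\mathrm{coker}(\mathrm{dv})\otimes\mathbb C/\mathbb Z$. Let $\mathrm{mon}\colon N\to\mathbb Z^\Xi$ be the map $\nu\mapsto(\langle\xi,\nu\rangle)_\xi$, and let $L\in\mathrm{coker}(\mathrm{mon})\otimes\mathbb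 C/\mathbb Z\cong(\mathbb C^*)^\Xi/T$ be the class of $(a_\xi)_\xi$, where $\mathbb C/\mathbb Z\cong\mathbb C^*$ via $z\mapsto e^{2\pi i z}$. The linear data of the model are $(\mathrm{dv},K)$, $(\mathrm{mon},L)$. Let $\Lambda$ be a lattice with dual $\Lambda^\vee$. For a linear map $C\colon \Lambda\to\mathbb Z^r$ and $c\in\mathbb R^r$, put $P=\{\xi\in \Lambda_{\mathbb R}: C\xi+c\ge0\}$. The pair $(C,c)$ is kopaseptic if $P$ has non-empty interior and, with $X(C,c)$ the toric variety of the inner normal fan of $P$, there is a surjection $\kappa\colon\mathbb Z^r\to\mathbb Z^{R_{X(C,c)}}$ which sends each standard generator to a standard generator or to $0$ and satisfies $\kappa\circ C=\mathrm{dv}_{X(C,c)}$. Let $A\colon\Lambda\to\mathbb Z^r$, $B\colon\Lambda^\vee\to\mathbb Z^s$ be linear, $K\in\mathrm{coker}(A)\otimes\mathbb C/\mathbb Z$ and $L\in\mathrm{coker}(B)\otimes\mathbb C/\mathbb Z$. The data $(A,K),(B,L)$ are kopaseptic if $(A,c)$ is kopaseptic for a lift $c\in\mathbb R^r$ of $\mathrm{Im}\,K$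 (different lifts translate $P$) and all entries of the matrix $AB^{T}$ are non-negative. They then define the model consisting of $X(A,c)$, of $W=\sum_{j=1}^s e^{2\pi i\ell_j}\xi_j$, where $\xi_j\in\Lambda$ is the $j$-th row of $B$ and $\ell\in\mathbb C^s$ lifts $L$ (different lifts differ by the action of the torus), and of the class induced from $K$ by $\kappa$. The dual of $(X,W,K)$ is the model defined by the exchanged data $(\mathrm{mon},L)$, $(\mathrm{dv},K)$. The model $(X,W,K)$ is self-dual if it is the model of its own linear data, and these and the exchanged data are kopaseptic, and its dual is isomorphic to it by an isomorphism of toric varieties which carries the superpotentials and the classes to each other. -/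

import Mathlib

open scoped TensorProduct

noncomputable section

namespace ToricLandauGinzburg

/-! ## Toric varieties

A toric variety of rank `|ι|` is given by its fan.  The lattice `N` of one-parameter subgroups and
the lattice `M` of characters are both written as `ι → ℤ` by means of dual bases, so that the
pairing is the dot product; `N_ℝ` and `M_ℝ` are `ι → ℝ`. -/

/-- The inclusion of the lattice `ℤ^ι` in `ℝ^ι`. -/
def toReal {ι : Type} (v : ι → ℤ) : ι → ℝ := fun j => (v j : ℝ)

/-- A strongly convex rational polyhedral cone. -/
structure IsStronglyConvexRational {ι : Type} (σ : PointedCone ℝ (ι → ℝ)) : Prop where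
  rational : ∃ S : Finset (ι → ℤ), σ = PointedCone.hull ℝ (toReal '' (S : Set (ι → ℤ)))
  strong : ∀ v ∈ σ, -v ∈ σ → v = 0

/-- A (finite, nonempty) fan of strongly convex rational polyhedral cones in `N_ℝ = ℝ^ι`. -/
structure Fan (ι : Type) where
  cones : Set (PointedCone ℝ (ι → ℝ))
  finite : cones.Finite
  nonempty : cones.Nonempty
  isCone : ∀ σ ∈ cones, IsStronglyConvexRational σ
  face_mem : ∀ σ ∈ cones, ∀ τ : PointedCone ℝ (ι → ℝ), τ.IsFaceOf σ → τ ∈ cones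
  inter_face : ∀ σ ∈ cones, ∀ τ ∈ cones, (σ ⊓ τ).IsFaceOf σ

/-- The primitive generators of the one-dimensional cones in `Σ`; they index the torus-invariant
prime divisors `R_X`. -/
def rays {ι : Type} [Fintype ι] (Sig : Set (PointedCone ℝ (ι → ℝ))) : Set (ι → ℤ) :=
  {v | Finset.univ.gcd v = 1 ∧ PointedCone.hull ℝ {toReal v} ∈ Sig}

/-- The matrix of the character-to-divisor map `dv : M → ℤ^R`, `χ ↦ (ord_D χ)_D`, where
`ord_D χ = ⟨χ, v_D⟩`: its rows are the primitive ray generators. -/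
def dv {ι : Type} [Fintype ι] (Sig : Set (PointedCone ℝ (ι → ℝ))) : Matrix (rays Sig) ι ℤ :=
  Matrix.of fun v j => v.1 j

theorem primitive_eq_of_hull_eq {ι : Type} [Fintype ι] {v w : ι → ℤ}
    (hv : Finset.univ.gcd v = 1) (hw : Finset.univ.gcd w = 1)
    (h : PointedCone.hull ℝ {toReal v} = PointedCone.hull ℝ {toReal w}) : v = w := by
  have hmem : toReal v ∈ PointedCone.hull ℝ {toReal w} := by
    rw [← h]; exact Submodule.subset_span rfl
  obtain ⟨a, ha⟩ := Submodule.mem_span_singleton.1 hmem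
  have hj : ∀ j, (a : ℝ) * w j = v j := fun j => congrFun ha j
  have hv0 : ∃ j, v j ≠ 0 := by
    by_contra! hcon
    have : Finset.univ.gcd v = 0 := Finset.gcd_eq_zero_iff.2 fun j _ => hcon j
    omega
  obtain ⟨j, hj0⟩ := hv0
  have hwj : w j ≠ 0 := by
    intro h0
    have := hj j
    rw [h0] at this
    exact hj0 (by exact_mod_cast (by simpa using this.symm : (v j : ℝ) = 0))
  have key : ∀ i, |w j| * v i = |v j| * w i := by
    intro i
    have h1 : (|v j| : ℝ) = a * |(w j : ℝ)| := by
      rw [← hj j, abs_mul, abs_of_nonneg a.2]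
    have h2 : ((|w j| * v i : ℤ) : ℝ) = ((|v j| * w i : ℤ) : ℝ) := by
      push_cast
      rw [h1, ← hj i]
      ring
    exact_mod_cast h2
  have e1 : Finset.univ.gcd (fun i => |w j| * v i) = |w j| := by
    rw [Finset.gcd_mul_left, hv, mul_one, Int.normalize_of_nonneg (abs_nonneg _)]
  have e2 : Finset.univ.gcd (fun i => |v j| * w i) = |v j| := by
    rw [Finset.gcd_mul_left, hw, mul_one, Int.normalize_of_nonneg (abs_nonneg _)]
  have e3 : |w j| = |v j| := by rw [← e1, ← e2]; congr 1; funext i; exact key i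
  funext i
  have := key i
  rw [e3] at this
  exact mul_left_cancel₀ (abs_ne_zero.2 hj0) this

instance Fan.finite_rays {ι : Type} [Fintype ι] (F : Fan ι) : Finite (rays F.cones) := by
  have : Finite F.cones := F.finite
  refine Finite.of_injective
    (fun v : rays F.cones => (⟨PointedCone.hull ℝ {toReal v.1}, v.2.2⟩ : F.cones)) ?_
  intro v w h
  exact Subtype.ext (primitive_eq_of_hull_eq v.2.1 w.2.1 (congrArg Subtype.val h))

/-! ## Chow groups and classes with `ℂ/ℤ`-coefficients -/

/-- The group `ℂ/ℤ`. -/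
abbrev CmodZ : Type := ℂ ⧸ AddSubgroup.zmultiples (1 : ℂ)

/-- The imaginary part `ℂ/ℤ → ℝ`. -/
def imCmodZ : CmodZ →+ ℝ :=
  QuotientAddGroup.lift (AddSubgroup.zmultiples (1 : ℂ)) Complex.imAddGroupHom (by
    intro x hx
    obtain ⟨n, rfl⟩ := AddSubgroup.mem_zmultiples_iff.1 hx
    simp)

/-- The cokernel of the linear map `ℤ^ι → ℤ^r` with matrix `A`.  For `A = dv X` it is the Chow
group `A_{n-1}(X)`. -/
abbrev Coker {ι r : Type} [Fintype ι] (A : Matrix r ι ℤ) : Type :=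
  (r → ℤ) ⧸ LinearMap.range A.mulVecLin

/-- The element of `coker A ⊗ V` represented by a vector `c ∈ V^r = ℤ^r ⊗ V`. -/
def tensorClass {ι r : Type} [Fintype ι] [Fintype r] (A : Matrix r ι ℤ)
    {V : Type} [AddCommGroup V] (c : r → V) : Coker A ⊗[ℤ] V :=
  open scoped Classical in
  ∑ i, (Submodule.Quotient.mk (Pi.single i 1) : Coker A) ⊗ₜ[ℤ] c i

/-- The imaginary part `coker A ⊗ ℂ/ℤ → coker A ⊗ ℝ`. -/
def imClass {ι r : Type} [Fintype ι] (A : Matrix r ι ℤ) :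
    Coker A ⊗[ℤ] CmodZ →ₗ[ℤ] Coker A ⊗[ℤ] ℝ :=
  LinearMap.lTensor (Coker A) imCmodZ.toIntLinearMap

/-- The map `coker A ⊗ ℂ/ℤ → coker B ⊗ ℂ/ℤ` induced by a commutative square `φ ∘ A = B ∘ ψ`. -/
def cokerMap {ι κ r s : Type} [Fintype ι] [Fintype κ] (A : Matrix r ι ℤ) (B : Matrix s κ ℤ)
    (φ : (r → ℤ) →ₗ[ℤ] (s → ℤ)) (ψ : (ι → ℤ) →ₗ[ℤ] (κ → ℤ))
    (h : φ ∘ₗ A.mulVecLin = B.mulVecLin ∘ₗ ψ) :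
    Coker A ⊗[ℤ] CmodZ →ₗ[ℤ] Coker B ⊗[ℤ] CmodZ :=
  LinearMap.rTensor CmodZ (Submodule.mapQ _ _ φ (by
    rintro _ ⟨x, rfl⟩
    exact ⟨ψ x, (LinearMap.congr_fun h x).symm⟩))

/-! ## The toric variety of a polyhedral set -/

/-- The polyhedral set `P = {ξ ∈ M_ℝ ; C ξ + c ≥ 0}`. -/
def polyhedron {ι r : Type} [Fintype ι] (C : Matrix r ι ℤ) (c : r → ℝ) : Set (ι → ℝ) :=
  {ξ | ∀ i, 0 ≤ toReal (C i) ⬝ᵥ ξ + c i}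

/-- The inner normal cone of `P` at `p`: all `v ∈ N_ℝ` which attain their minimum on `P` at `p`. -/
def normalCone {ι : Type} [Fintype ι] (P : Set (ι → ℝ)) (p : ι → ℝ) : PointedCone ℝ (ι → ℝ) where
  carrier := {v | ∀ x ∈ P, p ⬝ᵥ v ≤ x ⬝ᵥ v}
  zero_mem' := by intro x _; simp
  add_mem' := by
    intro v w hv hw x hx
    rw [dotProduct_add, dotProduct_add]
    exact add_le_add (hv x hx) (hw x hx)
  smul_mem' := by
    intro a v hv x hx
    have h := mul_le_mul_of_nonneg_left (hv x hx) a.2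
    have e : ∀ y : ι → ℝ, y ⬝ᵥ (a • v) = (a : ℝ) * (y ⬝ᵥ v) := fun y => dotProduct_smul (a : ℝ) y v
    rw [e, e]
    exact h

/-- The cones of the toric variety `X(C,c)`: the inner normal fan of the polyhedral set of `(C,c)`.
The normal cone of a face `Q` of `P` is the normal cone at any point of the relative interior of
`Q`. -/
def polyhedralCones {ι r : Type} [Fintype ι] (C : Matrix r ι ℤ) (c : r → ℝ) :
    Set (PointedCone ℝ (ι → ℝ)) :=
  {σ | ∃ p ∈ polyhedron C c, σ = normalCone (polyhedron C c) p}

/-- `k : ℤ^r → ℤ^R` is a surjection which sends standard generators to standard generators or to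
zero, and `k ∘ C = dv`. -/
structure IsReduction {ι r : Type} [Fintype ι] (C : Matrix r ι ℤ)
    (Sig : Set (PointedCone ℝ (ι → ℝ))) (k : (r → ℤ) →ₗ[ℤ] (rays Sig → ℤ)) : Prop where
  surjective : Function.Surjective k
  map_single : open scoped Classical in
    ∀ i, k (Pi.single i 1) = 0 ∨ ∃ ρ, k (Pi.single i 1) = Pi.single ρ 1
  comm : k ∘ₗ C.mulVecLin = (dv Sig).mulVecLin ∘ₗ LinearMap.id

/-- The `ℝ`-linear data `(C,c)` is kopaseptic. -/
def IsKopasepticReal {ι r : Type} [Fintype ι] (C : Matrix r ι ℤ) (c : r → ℝ) : Prop :=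
  (interior (polyhedron C c)).Nonempty ∧ ∃ k, IsReduction C (polyhedralCones C c) k

/-! ## Toric Landau–Ginzburg models -/

/-- A toric Landau–Ginzburg model `(X, W, K)`: a toric variety `X`, a regular function `W` on `X`,
written as a Laurent polynomial on the torus, and a class `K ∈ A_{n-1}(X) ⊗ ℂ/ℤ`.  The function `W`
is regular when all its monomials belong to `σ^∨ ∩ M` for each cone `σ` of the fan. -/
structure ToricLG (ι : Type) [Fintype ι] where
  fan : Fan ι
  W : AddMonoidAlgebra ℂ (ι → ℤ)
  regular : ∀ ξ ∈ W.coeff.support, ∀ σ ∈ fan.cones, ∀ v ∈ σ, 0 ≤ toReal ξ ⬝ᵥ v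
  K : Coker (dv fan.cones) ⊗[ℤ] CmodZ

/-- One half of `ℂ/ℤ`-linear data: a linear map `ℤ^ι → ℤ^r` and an element of its cokernel
with coefficients in `ℂ/ℤ`. -/
structure LinearDatum (ι : Type) [Fintype ι] where
  r : Type
  fintype_r : Fintype r
  mat : Matrix r ι ℤ
  cls : Coker mat ⊗[ℤ] CmodZ

attribute [instance] LinearDatum.fintype_r

/-- The datum `(dv(X), K)` of `(X, W, K)`. -/
def ToricLG.dvDatum {ι : Type} [Fintype ι] (X : ToricLG ι) : LinearDatum ι where
  r := rays X.fan.cones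
  fintype_r := Fintype.ofFinite _
  mat := dv X.fan.cones
  cls := X.K

/-- The matrix of `mon : N → ℤ^Ξ`, where `Ξ` is the set of monomials of `W`: its rows are the
exponent vectors of the monomials. -/
def ToricLG.mon {ι : Type} [Fintype ι] (X : ToricLG ι) : Matrix X.W.coeff.support ι ℤ :=
  Matrix.of fun ξ j => ξ.1 j

/-- The datum `(mon, L)` of `(X, W, K)`.  Here `L` is the class of the coefficients of `W` under
`(ℂ^*)^Ξ / T ≅ coker(mon) ⊗ ℂ/ℤ`, where `ℂ/ℤ ≅ ℂ^*` by `z ↦ exp (2πiz)`. -/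
def ToricLG.monDatum {ι : Type} [Fintype ι] (X : ToricLG ι) : LinearDatum ι where
  r := X.W.coeff.support
  fintype_r := inferInstance
  mat := X.mon
  cls := tensorClass X.mon fun ξ =>
    ((Complex.log (X.W.coeff ξ.1) / (2 * Real.pi * Complex.I) : ℂ) : CmodZ)

/-- `X` is the toric Landau–Ginzburg model `(X(A, Im K), W(B, L), K)` of the kopaseptic
`ℂ/ℤ`-linear data `(A, K)`, `(B, L)`.  A lift `c ∈ ℝ^r` of `Im K` is determined up to a translation
of the polyhedral set, and a lift of `L` up to the action of the torus on the coefficients of `W`.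
The class `K` is transported to the Chow group of `X` by the map which removes redundant rows. -/
def IsModelOf {ι : Type} [Fintype ι] (A B : LinearDatum ι) (X : ToricLG ι) : Prop :=
  (∃ c : A.r → ℝ, tensorClass A.mat c = imClass A.mat A.cls ∧ IsKopasepticReal A.mat c ∧
    X.fan.cones = polyhedralCones A.mat c) ∧
  (∀ i j, 0 ≤ (A.mat * B.mat.transpose) i j) ∧
  (∃ (k : (A.r → ℤ) →ₗ[ℤ] (rays X.fan.cones → ℤ)) (hk : IsReduction A.mat X.fan.cones k),
    X.K = cokerMap A.mat (dv X.fan.cones) k LinearMap.id hk.comm A.cls) ∧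
  (∃ l : B.r → ℂ, tensorClass B.mat (fun i => (l i : CmodZ)) = B.cls ∧
    X.W = ∑ i, AddMonoidAlgebra.single (B.mat i)
      (Complex.exp (2 * Real.pi * Complex.I * l i)))

/-- `Y` is the dual of `X`: the model of the linear data in which `(dv(X), K)` and `(mon, L)` are
exchanged. -/
def IsDual {ι : Type} [Fintype ι] (X Y : ToricLG ι) : Prop :=
  IsModelOf X.monDatum X.dvDatum Y

/-- An isomorphism `f : X → Y` of toric Landau–Ginzburg models, given by an isomorphism `G` of the
lattices of one-parameter subgroups: it carries the fan of `X` to the fan of `Y`, and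
`f^* W_Y = W_X`, `f^* K_Y = K_X`.  On characters, `f^*` is the transpose of `G`. -/
def IsIso {ι : Type} [Fintype ι] [DecidableEq ι] (X Y : ToricLG ι) : Prop :=
  ∃ G : Matrix.GeneralLinearGroup ι ℤ,
    Y.fan.cones = PointedCone.map (Matrix.mulVecLin (G.1.map (fun n : ℤ => (n : ℝ)))) ''
      X.fan.cones ∧
    X.W = AddMonoidAlgebra.mapDomain (fun ξ => Matrix.mulVec G.1.transpose ξ) Y.W ∧
    ∃ e : rays X.fan.cones → rays Y.fan.cones,
      (∀ v, (e v : ι → ℤ) = Matrix.mulVec G.1 v) ∧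
      ∃ h : LinearMap.funLeft ℤ ℤ e ∘ₗ (dv Y.fan.cones).mulVecLin =
          (dv X.fan.cones).mulVecLin ∘ₗ G.1.transpose.mulVecLin,
        X.K = cokerMap (dv Y.fan.cones) (dv X.fan.cones) (LinearMap.funLeft ℤ ℤ e)
          G.1.transpose.mulVecLin h Y.K

/-- `(X, W, K)` is self-dual: it is the model of its own (kopaseptic) linear data, and its dual
exists and is isomorphic to it. -/
def IsSelfDual {ι : Type} [Fintype ι] [DecidableEq ι] (X : ToricLG ι) : Prop :=
  IsModelOf X.dvDatum X.monDatum X ∧ ∃ Y : ToricLG ι, IsDual X Y ∧ IsIso Y X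

/-! ## The total space of `O(-k)` on the projective line -/

/-- The cone of the affine toric chart `Spec ℂ[S]`: all `v ∈ N_ℝ` which are nonnegative on the
monoid `S` of characters. -/
def chartCone {ι : Type} [Fintype ι] (S : AddSubmonoid (ι → ℤ)) : PointedCone ℝ (ι → ℝ) where
  carrier := {v | ∀ m ∈ S, 0 ≤ toReal m ⬝ᵥ v}
  zero_mem' := by intro m _; simp
  add_mem' := by
    intro v w hv hw m hm
    rw [dotProduct_add]
    exact add_nonneg (hv m hm) (hw m hm)
  smul_mem' := by
    intro a v hv m hm
    have e : toReal m ⬝ᵥ (a • v) = (a : ℝ) * (toReal m ⬝ᵥ v) := dotProduct_smul (a : ℝ) _ v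
    rw [e]
    exact mul_nonneg a.2 (hv m hm)

/-- The monoids of characters of the two charts `Spec ℂ[z, u]` and `Spec ℂ[z⁻¹, z^k u]` of
`Tot(O_{ℙ¹}(-k))`, where `z = t₁` is the coordinate on the base and `u = t₂` the coordinate on the
fibre. -/
def totChart (k : ℕ) : Bool → AddSubmonoid (Fin 2 → ℤ)
  | false => AddSubmonoid.closure {![1, 0], ![0, 1]}
  | true => AddSubmonoid.closure {![-1, 0], ![(k : ℤ), 1]}

/-- The primitive generators of the cones of the two charts. -/
def totGens (k : ℕ) : Bool → Finset (Fin 2 → ℤ)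
  | false => {![1, 0], ![0, 1]}
  | true => {![-1, (k : ℤ)], ![0, 1]}

theorem mem_chartCone_closure {S : Set (Fin 2 → ℤ)} {v : Fin 2 → ℝ} :
    v ∈ chartCone (AddSubmonoid.closure S) ↔ ∀ m ∈ S, 0 ≤ toReal m ⬝ᵥ v := by
  refine ⟨fun h m hm => h m (AddSubmonoid.subset_closure hm), fun h m hm => ?_⟩
  induction hm using AddSubmonoid.closure_induction with
  | mem x hx => exact h x hx
  | zero => simp [toReal, dotProduct]
  | add x y _ _ hx hy =>
    have e : toReal (x + y) = toReal x + toReal y := by funext j; simp [toReal]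
    rw [e, add_dotProduct]
    exact add_nonneg hx hy

theorem mem_totChart_false {k : ℕ} {v : Fin 2 → ℝ} :
    v ∈ chartCone (totChart k false) ↔ 0 ≤ v 0 ∧ 0 ≤ v 1 := by
  simp [totChart, mem_chartCone_closure, toReal, dotProduct, Fin.sum_univ_two]

theorem mem_totChart_true {k : ℕ} {v : Fin 2 → ℝ} :
    v ∈ chartCone (totChart k true) ↔ v 0 ≤ 0 ∧ 0 ≤ k * v 0 + v 1 := by
  simp [totChart, mem_chartCone_closure, toReal, dotProduct, Fin.sum_univ_two]

theorem totGens_mem (k : ℕ) (b : Bool) {g : Fin 2 → ℤ} (hg : g ∈ totGens k b) :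
    toReal g ∈ chartCone (totChart k b) := by
  cases b <;> simp [totGens] at hg <;> rcases hg with rfl | rfl <;>
    simp [mem_totChart_false, mem_totChart_true, toReal]

/-- Each face of a chart cone is generated by the generators which it contains. -/
theorem face_eq_hull (k : ℕ) (b : Bool) {F : PointedCone ℝ (Fin 2 → ℝ)}
    (hF : F.IsFaceOf (chartCone (totChart k b))) :
    F = PointedCone.hull ℝ (toReal '' {g | g ∈ totGens k b ∧ toReal g ∈ F}) := by
  apply le_antisymm
  · have key : ∀ g h : Fin 2 → ℤ, g ∈ totGens k b → h ∈ totGens k b → ∀ x y : ℝ, 0 ≤ x → 0 ≤ y →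
        x • toReal g + y • toReal h ∈ F → x • toReal g + y • toReal h ∈
          PointedCone.hull ℝ (toReal '' {g | g ∈ totGens k b ∧ toReal g ∈ F}) := by
      intro g h hg hh x y hx hy hz
      have hg' := totGens_mem k b hg
      have hh' := totGens_mem k b hh
      have hxm : x • toReal g ∈ F := hF.mem_of_add_mem_left
        (PointedCone.smul_mem _ hx hg') (PointedCone.smul_mem _ hy hh') hz
      have hym : y • toReal h ∈ F := hF.mem_of_add_mem_right
        (PointedCone.smul_mem _ hx hg') (PointedCone.smul_mem _ hy hh') hz
      have aux : ∀ (g : Fin 2 → ℤ) (x : ℝ), g ∈ totGens k b → 0 ≤ x → x • toReal g ∈ F →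
          x • toReal g ∈
            PointedCone.hull ℝ (toReal '' {g | g ∈ totGens k b ∧ toReal g ∈ F}) := by
        intro g x hg hx hxF
        rcases hx.eq_or_lt with rfl | hx
        · rw [zero_smul]; exact Submodule.zero_mem _
        · exact PointedCone.smul_mem _ hx.le (PointedCone.subset_hull
            ⟨g, ⟨hg, (PointedCone.smul_mem_iff F hx).1 hxF⟩, rfl⟩)
      exact Submodule.add_mem _ (aux g x hg hx hxm) (aux h y hh hy hym)
    intro v hv
    have hvb := hF.le hv
    cases b
    · rw [mem_totChart_false] at hvb
      have e : v = v 0 • toReal ![1, 0] + v 1 • toReal ![0, 1] := by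
        funext j; fin_cases j <;> simp [toReal]
      rw [e] at hv ⊢
      exact key _ _ (by simp [totGens]) (by simp [totGens]) _ _ hvb.1 hvb.2 hv
    · rw [mem_totChart_true] at hvb
      have e : v = (-v 0) • toReal ![-1, (k : ℤ)] + (k * v 0 + v 1) • toReal ![0, 1] := by
        funext j
        fin_cases j
        · simp [toReal]
        · simp [toReal]
          ring
      rw [e] at hv ⊢
      exact key _ _ (by simp [totGens]) (by simp [totGens]) _ _ (by linarith [hvb.1]) hvb.2 hv
  · refine Submodule.span_le.2 ?_
    rintro _ ⟨g, ⟨_, hg⟩, rfl⟩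
    exact hg

theorem chartCone_strong (k : ℕ) (b : Bool) {v : Fin 2 → ℝ}
    (h : v ∈ chartCone (totChart k b)) (h' : -v ∈ chartCone (totChart k b)) : v = 0 := by
  have key : v 0 = 0 ∧ v 1 = 0 := by
    cases b
    · rw [mem_totChart_false] at h h'
      simp only [Pi.neg_apply] at h'
      constructor <;> linarith [h.1, h.2, h'.1, h'.2]
    · rw [mem_totChart_true] at h h'
      simp only [Pi.neg_apply] at h'
      have h0 : v 0 = 0 := by linarith [h.1, h'.1]
      rw [h0] at h h'
      refine ⟨h0, ?_⟩
      linarith [h.2, h'.2]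
  funext j
  fin_cases j
  · exact key.1
  · exact key.2

theorem chartCone_inter_face (k : ℕ) (b b' : Bool) :
    (chartCone (totChart k b) ⊓ chartCone (totChart k b')).IsFaceOf
      (chartCone (totChart k b)) := by
  cases b <;> cases b'
  · rw [inf_idem]
  · refine ⟨inf_le_left, ?_⟩
    intro x y a hx hy ha hz
    rw [Submodule.mem_inf, mem_totChart_false, mem_totChart_true] at *
    simp only [Pi.add_apply, Pi.smul_apply, smul_eq_mul] at hz
    have h0 : x 0 = 0 := by
      have h1 : a * x 0 ≤ 0 := by linarith [hz.2.1, hy.1]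
      exact le_antisymm (by by_contra! hc; linarith [mul_pos ha hc]) hx.1
    rw [h0]
    exact ⟨⟨le_refl _, hx.2⟩, le_refl _, by simpa using hx.2⟩
  · refine ⟨inf_le_left, ?_⟩
    intro x y a hx hy ha hz
    rw [Submodule.mem_inf, mem_totChart_true, mem_totChart_false] at *
    simp only [Pi.add_apply, Pi.smul_apply, smul_eq_mul] at hz
    have h0 : x 0 = 0 := by
      have h1 : 0 ≤ a * x 0 := by linarith [hz.2.1, hy.1]
      exact le_antisymm hx.1 (by by_contra! hc; linarith [mul_neg_of_pos_of_neg ha hc])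
    rw [h0] at hx ⊢
    exact ⟨⟨le_refl _, hx.2⟩, le_refl _, by simpa using hx.2⟩
  · rw [inf_idem]

/-- The toric variety `Tot(O_{ℙ¹}(-k))`: the fan which consists of the cones of the two charts and
their faces. -/
def totFan (k : ℕ) : Fan (Fin 2) where
  cones := {τ | ∃ b : Bool, τ.IsFaceOf (chartCone (totChart k b))}
  finite := by
    refine Set.Finite.subset (Set.Finite.image
      (fun S : Set (Fin 2 → ℤ) => PointedCone.hull ℝ (toReal '' S))
      (Set.Finite.finite_subsets (Set.Finite.union (totGens k false).finite_toSet
        (totGens k true).finite_toSet))) ?_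
    rintro τ ⟨b, hτ⟩
    refine ⟨{g | g ∈ totGens k b ∧ toReal g ∈ τ}, ?_, (face_eq_hull k b hτ).symm⟩
    rintro g ⟨hg, _⟩
    cases b
    · exact Or.inl hg
    · exact Or.inr hg
  nonempty := ⟨_, false, PointedCone.IsFaceOf.rfl⟩
  isCone := by
    rintro τ ⟨b, hτ⟩
    refine ⟨?_, fun v hv hv' => chartCone_strong k b (hτ.le hv) (hτ.le hv')⟩
    classical
    refine ⟨(totGens k b).filter fun g => toReal g ∈ τ, ?_⟩
    rw [Finset.coe_filter]
    exact face_eq_hull k b hτ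
  face_mem := by
    rintro σ ⟨b, hσ⟩ τ hτ
    exact ⟨b, hτ.trans hσ⟩
  inter_face := by
    rintro σ ⟨b, hσ⟩ τ ⟨b', hτ⟩
    have h1 := (hσ.inf hτ).trans (chartCone_inter_face k b b')
    exact (h1.isFaceOf_iff_le hσ).2 inf_le_left

/-- The superpotential `a₀ t₂ + a₁ t₁ t₂ + ⋯ + a_k t₁^k t₂` determined by a global section of
`O_{ℙ¹}(k)`, that is, by a polynomial `a₀ + a₁ t₁ + ⋯ + a_k t₁^k`. -/
def sectionPotential (k : ℕ) (a : Fin (k + 1) → ℂ) : AddMonoidAlgebra ℂ (Fin 2 → ℤ) :=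
  ∑ i : Fin (k + 1), AddMonoidAlgebra.single ![((i : ℕ) : ℤ), 1] (a i)

end ToricLandauGinzburg

end

noncomputable section

namespace ToricLandauGinzburg

/-! Necessity of `k = 2`. The superpotential of the dual is a sum over the rays of `X` with
exponentials as coefficients, so its monomials are exactly the primitive ray generators. An
isomorphism of the dual with `X` therefore writes `(1,0)`, `(0,1)`, `(-1,k)` as images, under one
invertible integral matrix, of monomials of `W`, and these all lie on the line `ξ 1 = 1`. The
relation `(1,0) + (-1,k) = k • (0,1)` pulls back to the monomials, and its second coordinate reads
`1 + 1 = k` (`eq_two_of_isSelfDual`).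

Sufficiency. For `k = 2` the symmetric matrix `mirrorMap` takes the rays `(1,0)`, `(0,1)`, `(-1,2)`
to the exponents `(0,1)`, `(1,1)`, `(2,1)`. The coefficients `e^{-2π}, 1, e^{-2π}` have logarithms
`i, 0, i` after division by `2πi`. Their imaginary parts `1, 0, 1` are the constants of a polyhedral
set with normal fan `totFan 2` (`totFan_two_cones`). Taking `K` to be the class of the same numbers,
placed on the corresponding rays, makes the two linear data correspond under `mirrorMap`. The dual
is then the image of the model under this matrix (`polyhedralCones_monDatum`, `isDual_mirrorModel`),
and the inverse matrix is the required isomorphism (`isIso_mirrorModel`). -/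

/-! ### Classes and reductions on representatives -/

theorem imClass_tensorClass {ι r : Type} [Fintype ι] [Fintype r] (A : Matrix r ι ℤ) (l : r → ℂ) :
    imClass A (tensorClass A fun i => (l i : CmodZ)) = tensorClass A fun i => (l i).im := by
  unfold tensorClass
  rw [map_sum]
  exact Finset.sum_congr rfl fun i _ => LinearMap.lTensor_tmul ..

/-- Pulling back along a bijection sends the generator at `σ i` to the generator at `i`. Classes can
thus be compared through their representing vectors. -/
theorem cokerMap_tensorClass {ι κ r s : Type} [Fintype ι] [Fintype κ] [Fintype r] [Fintype s]
    (A : Matrix r ι ℤ) (B : Matrix s κ ℤ) (σ : s ≃ r) (ψ : (ι → ℤ) →ₗ[ℤ] (κ → ℤ))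
    (h : LinearMap.funLeft ℤ ℤ σ ∘ₗ A.mulVecLin = B.mulVecLin ∘ₗ ψ) (c : r → CmodZ) :
    cokerMap A B (LinearMap.funLeft ℤ ℤ σ) ψ h (tensorClass A c) = tensorClass B (c ∘ σ) := by
  classical
  unfold tensorClass
  rw [map_sum, ← Equiv.sum_comp σ]
  refine Finset.sum_congr rfl fun i _ => ?_
  refine (LinearMap.rTensor_tmul ..).trans ?_
  rw [Submodule.mapQ_apply]
  congr 2
  funext j
  simp [LinearMap.funLeft_apply, Pi.single_apply]

/-- When the rows are exactly the primitive ray generators there is nothing to discard, and the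
surjection `κ` is a relabelling. -/
theorem isReduction_of_equiv {ι r : Type} [Fintype ι] {C : Matrix r ι ℤ}
    {Sig : Set (PointedCone ℝ (ι → ℝ))} (σ : rays Sig ≃ r) (h : ∀ v, C (σ v) = v.1) :
    IsReduction C Sig (LinearMap.funLeft ℤ ℤ σ) where
  surjective := LinearMap.funLeft_surjective_of_injective _ _ _ σ.injective
  map_single i := by
    classical
    refine Or.inr ⟨σ.symm i, ?_⟩
    funext j
    simp [LinearMap.funLeft_apply, Pi.single_apply, Equiv.eq_symm_apply]
  comm := by
    refine LinearMap.ext fun x => funext fun v => ?_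
    simp [LinearMap.funLeft_apply, Matrix.mulVec, dv, h]

theorem interior_polyhedron_nonempty {ι r : Type} [Fintype ι] [Finite r] {C : Matrix r ι ℤ}
    {c : r → ℝ} {ξ : ι → ℝ} (h : ∀ i, 0 < toReal (C i) ⬝ᵥ ξ + c i) :
    (interior (polyhedron C c)).Nonempty := by
  refine ⟨ξ, mem_interior.2 ⟨⋂ i, {ξ | 0 < toReal (C i) ⬝ᵥ ξ + c i}, ?_, ?_, ?_⟩⟩
  · exact fun x hx i => le_of_lt (Set.mem_iInter.1 hx i)
  · refine isOpen_iInter_of_finite fun i => isOpen_lt continuous_const ?_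
    simp only [dotProduct]
    fun_prop
  · exact Set.mem_iInter.2 h

theorem gcd_eq_one_of_gcd_mulVec {ι : Type} [Fintype ι] {A : Matrix ι ι ℤ} {v : ι → ℤ}
    (h : Finset.univ.gcd (A.mulVec v) = 1) : Finset.univ.gcd v = 1 := by
  have : Finset.univ.gcd v ∣ 1 := by
    rw [← h]
    refine Finset.dvd_gcd fun j _ => Finset.dvd_sum fun i hi => ?_
    exact Dvd.dvd.mul_left (Finset.gcd_dvd hi) _
  rw [← Finset.normalize_gcd]
  exact normalize_eq_one.2 (isUnit_of_dvd_one this)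

/-! ### Linear changes of coordinates -/

/-- The linear automorphism of `N_ℝ` defined by an automorphism of `N`. -/
abbrev realMap {ι : Type} [Fintype ι] [DecidableEq ι] (G : Matrix.GeneralLinearGroup ι ℤ) :
    (ι → ℝ) →ₗ[ℝ] (ι → ℝ) :=
  Matrix.mulVecLin (G.1.map (fun n : ℤ => (n : ℝ)))

section

variable {ι : Type} [Fintype ι] [DecidableEq ι]

theorem realMap_comp (G H : Matrix.GeneralLinearGroup ι ℤ) :
    realMap G ∘ₗ realMap H = realMap (G * H) := by
  rw [realMap, realMap, realMap, ← Matrix.mulVecLin_mul]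
  congr 1
  exact (Matrix.map_mul (f := Int.castRingHom ℝ)).symm

theorem realMap_one : realMap (1 : Matrix.GeneralLinearGroup ι ℤ) = LinearMap.id := by
  rw [realMap, ← Matrix.mulVecLin_one]
  congr 1
  exact Matrix.map_one _ (by simp) (by simp)

theorem realMap_injective (G : Matrix.GeneralLinearGroup ι ℤ) :
    Function.Injective (realMap G) := by
  have h : realMap G⁻¹ ∘ₗ realMap G = LinearMap.id := by
    rw [realMap_comp, inv_mul_cancel, realMap_one]
  exact Function.LeftInverse.injective (g := realMap G⁻¹) fun v => LinearMap.congr_fun h v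

theorem realMap_surjective (G : Matrix.GeneralLinearGroup ι ℤ) :
    Function.Surjective (realMap G) := by
  have h : realMap G ∘ₗ realMap G⁻¹ = LinearMap.id := by
    rw [realMap_comp, mul_inv_cancel, realMap_one]
  exact Function.RightInverse.surjective (g := realMap G⁻¹) fun v => LinearMap.congr_fun h v

theorem realMap_toReal (G : Matrix.GeneralLinearGroup ι ℤ) (v : ι → ℤ) :
    realMap G (toReal v) = toReal (G.1.mulVec v) := by
  funext j
  simp [realMap, toReal, Matrix.mulVec, dotProduct]

theorem map_hull_toReal (G : Matrix.GeneralLinearGroup ι ℤ) (S : Set (ι → ℤ)) :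
    PointedCone.map (realMap G) (PointedCone.hull ℝ (toReal '' S)) =
      PointedCone.hull ℝ (toReal '' (G.1.mulVec '' S)) := by
  have h : (realMap G).restrictScalars {c : ℝ // 0 ≤ c} '' (toReal '' S) =
      toReal '' (G.1.mulVec '' S) := by
    rw [Set.image_image, Set.image_image]
    exact Set.image_congr fun v _ => realMap_toReal G v
  rw [← h]
  exact Submodule.map_span _ _

/-- The image of a fan under an automorphism of the lattice. -/
def Fan.map (F : Fan ι) (G : Matrix.GeneralLinearGroup ι ℤ) : Fan ι where
  cones := PointedCone.map (realMap G) '' F.cones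
  finite := F.finite.image _
  nonempty := F.nonempty.image _
  isCone := by
    classical
    rintro _ ⟨σ, hσ, rfl⟩
    obtain ⟨⟨S, hS⟩, hs⟩ := F.isCone σ hσ
    refine ⟨⟨S.image G.1.mulVec, ?_⟩, ?_⟩
    · rw [hS, map_hull_toReal, Finset.coe_image]
    · rintro _ ⟨v, hv, rfl⟩ ⟨w, hw, hvw⟩
      have : w = -v := realMap_injective G (hvw.trans (map_neg (realMap G) v).symm)
      rw [hs v hv (this ▸ hw)]
      exact map_zero (realMap G)
  face_mem := by
    rintro _ ⟨σ, hσ, rfl⟩ τ hτ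
    -- A face of the image cone is the image of its preimage, and an injective map reflects the face
    -- relation.
    have e : PointedCone.map (realMap G) (PointedCone.comap (realMap G) τ) = τ := by
      ext v
      constructor
      · rintro ⟨w, hw, rfl⟩
        exact hw
      · intro hv
        obtain ⟨w, rfl⟩ := realMap_surjective G v
        exact ⟨w, hv, rfl⟩
    refine ⟨_, F.face_mem σ hσ (PointedCone.comap (realMap G) τ) ?_, e⟩
    exact PointedCone.IsFaceOf.of_map_injective (realMap_injective G) (e.symm ▸ hτ)
  inter_face := by
    rintro _ ⟨σ, hσ, rfl⟩ _ ⟨τ, hτ, rfl⟩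
    have e : PointedCone.map (realMap G) σ ⊓ PointedCone.map (realMap G) τ =
        PointedCone.map (realMap G) (σ ⊓ τ) := by
      ext v
      constructor
      · rintro ⟨⟨w, hw, rfl⟩, ⟨w', hw', h⟩⟩
        exact ⟨w, ⟨hw, realMap_injective G h ▸ hw'⟩, rfl⟩
      · rintro ⟨w, ⟨hw, hw'⟩, rfl⟩
        exact ⟨⟨w, hw, rfl⟩, ⟨w, hw', rfl⟩⟩
    rw [e]
    exact (F.inter_face σ hσ τ hτ).map _ (realMap_injective G)

/-- An integral matrix can only enlarge the gcd of the entries in the sense of divisibility; applied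
to `G` and to its inverse, this preserves primitivity in both directions. -/
theorem mulVec_mem_rays_map {F : Fan ι} (G : Matrix.GeneralLinearGroup ι ℤ) {v : ι → ℤ} :
    G.1.mulVec v ∈ rays (F.map G).cones ↔ v ∈ rays F.cones := by
  have e : PointedCone.hull ℝ {toReal (G.1.mulVec v)} =
      PointedCone.map (realMap G) (PointedCone.hull ℝ {toReal v}) := by
    have := map_hull_toReal G {v}
    rwa [Set.image_singleton, Set.image_singleton, Set.image_singleton, eq_comm] at this
  have hG : (G⁻¹).1.mulVec (G.1.mulVec v) = v := by
    rw [Matrix.mulVec_mulVec, ← Units.val_mul, inv_mul_cancel, Units.val_one, Matrix.one_mulVec]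
  constructor
  · rintro ⟨h, τ, hτ, hτe⟩
    refine ⟨gcd_eq_one_of_gcd_mulVec h, ?_⟩
    rw [e] at hτe
    have h : τ = PointedCone.hull ℝ {toReal v} := SetLike.coe_injective
      ((realMap_injective G).image_injective (congrArg SetLike.coe hτe))
    exact h ▸ hτ
  · rintro ⟨h, hv⟩
    refine ⟨gcd_eq_one_of_gcd_mulVec (A := (G⁻¹).1) (by rwa [hG]), _, hv, e.symm⟩

/-- Symmetry makes `G` self-adjoint for the dot product, so `G w` is minimal at `p` on the preimage
of `P` exactly when `w` is minimal at `G p` on `P`. -/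
theorem map_normalCone (G : Matrix.GeneralLinearGroup ι ℤ) (hG : G.1.transpose = G.1)
    (P : Set (ι → ℝ)) (p : ι → ℝ) :
    normalCone (realMap G ⁻¹' P) p = PointedCone.map (realMap G) (normalCone P (realMap G p)) := by
  have adj : ∀ x w, x ⬝ᵥ realMap G w = realMap G x ⬝ᵥ w := by
    intro x w
    simp only [realMap, Matrix.mulVecLin_apply]
    rw [Matrix.dotProduct_mulVec, ← Matrix.mulVec_transpose, ← Matrix.transpose_map, hG]
  ext v
  constructor
  · intro hv
    obtain ⟨w, rfl⟩ := realMap_surjective G v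
    refine ⟨w, fun y hy => ?_, rfl⟩
    obtain ⟨x, rfl⟩ := realMap_surjective G y
    rw [← adj, ← adj]
    exact hv x hy
  · rintro ⟨w, hw, rfl⟩ x hx
    have := hw _ hx
    rw [← adj, ← adj] at this
    exact this

end

/-- The intersection of the normal cones at two points is a face of each of them. -/
theorem normalCone_isFaceOf {ι : Type} [Fintype ι] {P : Set (ι → ℝ)} {p q : ι → ℝ} (hp : p ∈ P)
    (hq : q ∈ P) (h : normalCone P p ≤ normalCone P q) :
    (normalCone P p).IsFaceOf (normalCone P q) := by
  refine ⟨h, fun {v w a} hv hw ha hz x hx => ?_⟩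
  have h1 := hv p hp
  have h2 := hw p hp
  have h3 := hz q hq
  simp only [dotProduct_add, dotProduct_smul, smul_eq_mul] at h3
  -- Both `v` and `w` are at least as large at `p` as at `q`, while `a • v + w` is not larger at
  -- `p`; as `a > 0`, `v` takes equal values at both points.
  have h4 : p ⬝ᵥ v ≤ q ⬝ᵥ v := by
    by_contra! hc
    nlinarith [mul_lt_mul_of_pos_left hc ha]
  exact h4.trans (hv x hx)

/-! ### The rays of the total space -/

theorem hull_mem_totFan (k : ℕ) {v : Fin 2 → ℤ} (hv : ∃ b, v ∈ totGens k b) :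
    PointedCone.hull ℝ {toReal v} ∈ (totFan k).cones := by
  obtain ⟨b, hv⟩ := hv
  have hm := totGens_mem k b hv
  refine ⟨b, Submodule.span_le.2 (by rintro _ rfl; exact hm), ?_⟩
  intro x y a hx hy ha hz
  obtain ⟨c, hc⟩ := Submodule.mem_span_singleton.1 hz
  have h0 : (c : ℝ) * toReal v 0 = a * x 0 + y 0 := congrFun hc 0
  have h1 : (c : ℝ) * toReal v 1 = a * x 1 + y 1 := congrFun hc 1
  -- One of the two inequalities of the chart cone is an equality on the generator `v`. Its linear
  -- form is nonnegative on `x` and `y` and vanishes on `a • x + y`, hence it vanishes on `x`.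
  have key : ∃ d : ℝ, 0 ≤ d ∧ x = d • toReal v := by
    cases b <;> simp only [totGens, Finset.mem_insert, Finset.mem_singleton] at hv <;>
      rcases hv with rfl | rfl <;>
      simp only [mem_totChart_false, mem_totChart_true] at hx hy <;>
      simp [toReal] at h0 h1
    · refine ⟨x 0, hx.1, ?_⟩
      have : x 1 = 0 := by nlinarith [mul_nonneg ha.le hx.2]
      funext j; fin_cases j <;> simp [toReal, this]
    · refine ⟨x 1, hx.2, ?_⟩
      have : x 0 = 0 := by nlinarith [mul_nonneg ha.le hx.1]
      funext j; fin_cases j <;> simp [toReal, this]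
    · refine ⟨- x 0, by linarith [hx.1], ?_⟩
      have h3 : a * (k * x 0 + x 1) + (k * y 0 + y 1) = 0 := by
        have : (k : ℝ) * -c = k * (a * x 0 + y 0) := by rw [h0]
        linarith
      have : k * x 0 + x 1 = 0 := by nlinarith [mul_nonneg ha.le hx.2]
      funext j; fin_cases j
      · simp [toReal]
      · simp [toReal]; linarith
    · refine ⟨x 1, ?_, ?_⟩
      all_goals have : x 0 = 0 := by nlinarith [mul_nonneg ha.le (neg_nonneg.2 hx.1)]
      · simpa [this] using hx.2
      · funext j; fin_cases j <;> simp [toReal, this]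
  obtain ⟨d, hd, rfl⟩ := key
  exact PointedCone.smul_mem _ hd (PointedCone.subset_hull rfl)

theorem toReal_ne_zero {ι : Type} [Fintype ι] {v : ι → ℤ} (hv : Finset.univ.gcd v = 1) :
    toReal v ≠ 0 := by
  intro h0
  have : Finset.univ.gcd v = 0 :=
    Finset.gcd_eq_zero_iff.2 fun j _ => by simpa [toReal] using congrFun h0 j
  omega

/-- A ray of the fan is a face of a chart cone, hence spanned by the chart generators in it. As it
is nonzero it contains one, and two primitive vectors on the same ray coincide. -/
theorem mem_rays_totFan {k : ℕ} {v : Fin 2 → ℤ} :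
    v ∈ rays (totFan k).cones ↔ v = ![1, 0] ∨ v = ![0, 1] ∨ v = ![-1, (k : ℤ)] := by
  have hgcd : ∀ b, ∀ g ∈ totGens k b, Finset.univ.gcd g = 1 := by
    intro b g hg
    cases b <;> simp only [totGens, Finset.mem_insert, Finset.mem_singleton] at hg <;>
      rcases hg with rfl | rfl <;>
      · rw [show (Finset.univ : Finset (Fin 2)) = {0, 1} from rfl]
        simp [Finset.gcd_insert, ← Int.coe_gcd]
  have hgens : (∃ b, v ∈ totGens k b) ↔ v = ![1, 0] ∨ v = ![0, 1] ∨ v = ![-1, (k : ℤ)] := by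
    simp only [Bool.exists_bool, totGens, Finset.mem_insert, Finset.mem_singleton]
    tauto
  rw [← hgens]
  refine ⟨?_, fun h => ⟨hgcd _ _ h.choose_spec, hull_mem_totFan k h⟩⟩
  rintro ⟨hv, b, hF⟩
  have hmem : toReal v ∈ PointedCone.hull ℝ {toReal v} := PointedCone.subset_hull rfl
  rw [face_eq_hull k b hF] at hmem
  obtain ⟨g, hg, hgv⟩ :
      ∃ g ∈ totGens k b, toReal g ∈ PointedCone.hull ℝ {toReal v} := by
    by_contra! hcon
    have : {g | g ∈ totGens k b ∧ toReal g ∈ PointedCone.hull ℝ {toReal v}} = ∅ :=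
      Set.eq_empty_of_forall_notMem fun g hg => hcon g hg.1 hg.2
    rw [this, Set.image_empty, PointedCone.hull, Submodule.span_empty] at hmem
    exact toReal_ne_zero hv hmem
  refine ⟨b, ?_⟩
  have : g = v := by
    refine primitive_eq_of_hull_eq (hgcd b g hg) hv ?_
    refine le_antisymm (Submodule.span_le.2 (by rintro _ rfl; exact hgv)) ?_
    refine Submodule.span_le.2 ?_
    rintro _ rfl
    obtain ⟨a, ha⟩ := Submodule.mem_span_singleton.1 hgv
    have ha0 : a ≠ 0 := by
      rintro rfl
      exact toReal_ne_zero (hgcd b g hg) (by rw [← ha, zero_smul])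
    exact Submodule.mem_span_singleton.2 ⟨a⁻¹, by rw [← ha, inv_smul_smul₀ ha0]⟩
  exact this ▸ hg

/-! ### Self-duality forces degree two -/

theorem apply_one_of_mem_support_sectionPotential {k : ℕ} {a : Fin (k + 1) → ℂ} {ξ : Fin 2 → ℤ}
    (h : ξ ∈ (sectionPotential k a).coeff.support) : ξ 1 = 1 := by
  rw [Finsupp.mem_support_iff, sectionPotential, AddMonoidAlgebra.coeff_sum,
    Finset.sum_apply'] at h
  obtain ⟨i, -, hi⟩ := Finset.exists_ne_zero_of_sum_ne_zero h
  by_contra hne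
  rw [AddMonoidAlgebra.coeff_single, Finsupp.single_eq_of_ne'] at hi
  · exact hi rfl
  · rintro rfl
    exact hne rfl

theorem eq_two_of_isSelfDual {k : ℕ} {X : ToricLG (Fin 2)} (hfan : X.fan = totFan k)
    {a : Fin (k + 1) → ℂ} (hW : X.W = sectionPotential k a) (hX : IsSelfDual X) : k = 2 := by
  obtain ⟨-, Y, ⟨-, -, -, l, -, hYW⟩, G, -, hGW, -⟩ := hX
  have hsupp : ∀ v ∈ rays X.fan.cones, ∃ ξ : Fin 2 → ℤ, ξ 1 = 1 ∧ G.1.transpose.mulVec ξ = v := by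
    intro v hv
    -- Distinct rays give distinct monomials, so no cancellation occurs and the coefficient at `v`
    -- is a single exponential.
    have h1 : Y.W.coeff v ≠ 0 := by
      rw [hYW, AddMonoidAlgebra.coeff_sum, Finset.sum_apply']
      let i : X.dvDatum.r := (⟨v, hv⟩ : rays X.fan.cones)
      rw [Finset.sum_eq_single i]
      · have : X.dvDatum.mat i = v := rfl
        rw [AddMonoidAlgebra.coeff_single, this, Finsupp.single_eq_same]
        exact Complex.exp_ne_zero _
      · intro j _ hj
        rw [AddMonoidAlgebra.coeff_single]
        refine Finsupp.single_eq_of_ne' fun h => hj (Subtype.ext h)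
      · exact fun h => (h (Finset.mem_univ _)).elim
    rw [hGW, hW, AddMonoidAlgebra.coeff_mapDomain, ← Finsupp.mem_support_iff] at h1
    obtain ⟨ξ, hξ, rfl⟩ := Finset.mem_image.1 (Finsupp.mapDomain_support h1)
    exact ⟨ξ, apply_one_of_mem_support_sectionPotential hξ, rfl⟩
  have hr : ∀ v, v ∈ rays X.fan.cones ↔ v = ![1, 0] ∨ v = ![0, 1] ∨ v = ![-1, (k : ℤ)] :=
    fun v => by rw [hfan]; exact mem_rays_totFan
  obtain ⟨x, hx, hx'⟩ := hsupp ![1, 0] ((hr _).2 (Or.inl rfl))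
  obtain ⟨y, hy, hy'⟩ := hsupp ![0, 1] ((hr _).2 (Or.inr (Or.inl rfl)))
  obtain ⟨z, hz, hz'⟩ := hsupp ![-1, (k : ℤ)] ((hr _).2 (Or.inr (Or.inr rfl)))
  have hinj : Function.Injective G.1.transpose.mulVec := by
    refine Matrix.mulVec_injective_of_isUnit ?_
    exact (Matrix.isUnit_transpose _).2 G.isUnit
  -- This is the relation `(1,0) + (-1,k) = k • (0,1)` among the rays, pulled back to the monomials.
  have : x + z = (k : ℤ) • y := by
    apply hinj
    rw [Matrix.mulVec_add, Matrix.mulVec_smul, hx', hy', hz']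
    funext j
    fin_cases j <;> simp
  have h1 := congrFun this 1
  simp [hx, hy, hz] at h1
  omega

/-! ### The fan of degree two as a normal fan -/

/-- A polyhedral set whose inner normal fan is the fan of `Tot(O_{ℙ¹}(-2))`. -/
def totPolyhedron : Set (Fin 2 → ℝ) := {m | 0 ≤ m 0 + 1 ∧ 0 ≤ m 1 ∧ 0 ≤ -m 0 + 2 * m 1 + 1}

theorem mem_normalCone_iff {P : Set (Fin 2 → ℝ)} {p v : Fin 2 → ℝ} :
    v ∈ normalCone P p ↔ ∀ x ∈ P, p 0 * v 0 + p 1 * v 1 ≤ x 0 * v 0 + x 1 * v 1 := by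
  change (∀ x ∈ P, p ⬝ᵥ v ≤ x ⬝ᵥ v) ↔ _
  simp only [dotProduct, Fin.sum_univ_two]

/-- For `p 0 ≤ 0` the set contains `p + (1,0)` and `p + (0,1)`. A functional minimal at `p` is
nonnegative on these two steps, which generate the monoid of the chart. -/
theorem normalCone_le_chartCone_false {p : Fin 2 → ℝ} (hp : p ∈ totPolyhedron) (h : p 0 ≤ 0) :
    normalCone totPolyhedron p ≤ chartCone (totChart 2 false) := by
  intro v hv
  rw [mem_normalCone_iff] at hv
  obtain ⟨h1, h2, h3⟩ := hp
  rw [mem_totChart_false]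
  have e1 := hv ![p 0 + 1, p 1] ⟨by simp; linarith, by simpa, by simp; linarith⟩
  have e2 := hv ![p 0, p 1 + 1] ⟨by simp; linarith, by simp; linarith, by simp; linarith⟩
  simp at e1 e2
  constructor <;> linarith

/-- The steps are now `(-1,0)` and `(2,1)`, the generators of the other chart's monoid. -/
theorem normalCone_le_chartCone_true {p : Fin 2 → ℝ} (hp : p ∈ totPolyhedron) (h : 0 ≤ p 0) :
    normalCone totPolyhedron p ≤ chartCone (totChart 2 true) := by
  intro v hv
  rw [mem_normalCone_iff] at hv
  obtain ⟨h1, h2, h3⟩ := hp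
  rw [mem_totChart_true]
  have e1 := hv ![p 0 - 1, p 1] ⟨by simp; linarith, by simpa, by simp; linarith⟩
  have e2 := hv ![p 0 + 2, p 1 + 1] ⟨by simp; linarith, by simp; linarith, by simp; linarith⟩
  simp at e1 e2
  constructor
  · linarith
  · push_cast
    linarith

/-- The vertices of the polyhedral set. -/
def totVertex : Bool → Fin 2 → ℝ
  | false => ![-1, 0]
  | true => ![1, 0]

theorem totVertex_mem (b : Bool) : totVertex b ∈ totPolyhedron := by
  cases b <;> norm_num [totVertex, totPolyhedron]

theorem normalCone_totVertex (b : Bool) :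
    normalCone totPolyhedron (totVertex b) = chartCone (totChart 2 b) := by
  cases b
  · refine le_antisymm (normalCone_le_chartCone_false (totVertex_mem _) (by simp [totVertex])) ?_
    intro v hv
    rw [mem_totChart_false] at hv
    rw [mem_normalCone_iff]
    rintro x ⟨h1, h2, h3⟩
    simp [totVertex]
    nlinarith [mul_nonneg h1 hv.1, mul_nonneg h2 hv.2]
  · refine le_antisymm (normalCone_le_chartCone_true (totVertex_mem _) (by simp [totVertex])) ?_
    intro v hv
    rw [mem_totChart_true] at hv
    rw [mem_normalCone_iff]
    rintro x ⟨h1, h2, h3⟩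
    simp [totVertex]
    have := hv.2
    push_cast at this
    -- The difference of values at `x` and at the vertex is `(-x 0 + 2 * x 1 + 1) * (-v 0) + x 1 *
    -- (2 * v 0 + v 1)`.
    nlinarith [mul_nonneg h3 (neg_nonneg.2 hv.1), mul_nonneg h2 this]

theorem normalCone_isFaceOf_chartCone {p : Fin 2 → ℝ} (hp : p ∈ totPolyhedron) (b : Bool)
    (h : normalCone totPolyhedron p ≤ chartCone (totChart 2 b)) :
    (normalCone totPolyhedron p).IsFaceOf (chartCone (totChart 2 b)) := by
  rw [← normalCone_totVertex] at h ⊢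
  exact normalCone_isFaceOf hp (totVertex_mem b) h

/-- A generator of a cone belongs to the normal cone of `p` if and only if the corresponding
inequality is an equality at `p`. -/
theorem toReal_mem_normalCone_totPolyhedron {p : Fin 2 → ℝ} (hp : p ∈ totPolyhedron) :
    (toReal ![1, 0] ∈ normalCone totPolyhedron p ↔ p 0 = -1) ∧
    (toReal ![0, 1] ∈ normalCone totPolyhedron p ↔ p 1 = 0) ∧
    (toReal ![-1, 2] ∈ normalCone totPolyhedron p ↔ -p 0 + 2 * p 1 = -1) := by
  obtain ⟨h1, h2, h3⟩ := hp
  simp only [mem_normalCone_iff, toReal]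
  refine ⟨⟨fun h => ?_, fun h x hx => ?_⟩, ⟨fun h => ?_, fun h x hx => ?_⟩,
    ⟨fun h => ?_, fun h x hx => ?_⟩⟩
  -- Each of the three functionals attains the bound in its inequality at the vertex tested here and
  -- below.
  · have := h ![-1, 0] (totVertex_mem false)
    simp at this
    linarith
  · have := hx.1
    simp
    linarith
  · have := h ![-1, 0] (totVertex_mem false)
    simp at this
    linarith
  · have := hx.2.1
    simp
    linarith
  · have := h ![1, 0] (totVertex_mem true)
    simp at this
    linarith
  · have := hx.2.2
    simp
    linarith

/-- A point of the face on which exactly the inequalities of the given generators are equalities. -/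
theorem exists_face_point (b : Bool) (S : Finset (Fin 2 → ℤ)) :
    ∃ p ∈ totPolyhedron, normalCone totPolyhedron p ≤ chartCone (totChart 2 b) ∧
      ∀ g ∈ totGens 2 b, toReal g ∈ normalCone totPolyhedron p ↔ g ∈ S := by
  have key : ∀ p ∈ totPolyhedron, normalCone totPolyhedron p ≤ chartCone (totChart 2 b) →
      (∀ g ∈ totGens 2 b, toReal g ∈ normalCone totPolyhedron p ↔ g ∈ S) →
      ∃ p ∈ totPolyhedron, normalCone totPolyhedron p ≤ chartCone (totChart 2 b) ∧
      ∀ g ∈ totGens 2 b, toReal g ∈ normalCone totPolyhedron p ↔ g ∈ S :=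
    fun p hp h h' => ⟨p, hp, h, h'⟩
  cases b
  · have fin : ∀ p ∈ totPolyhedron, p 0 ≤ 0 → (p 0 = -1 ↔ ![1, 0] ∈ S) → (p 1 = 0 ↔ ![0, 1] ∈ S) →
        _ := fun p hp h0 h1 h2 => key p hp (normalCone_le_chartCone_false hp h0) (by
      have := toReal_mem_normalCone_totPolyhedron hp
      intro g hg
      simp only [totGens, Finset.mem_insert, Finset.mem_singleton] at hg
      rcases hg with rfl | rfl
      · exact this.1.trans h1
      · exact this.2.1.trans h2)
    -- The witnesses are the vertex, a point of the unbounded edge, a point of the bounded edge and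
    -- an interior point, all on the side `p 0 ≤ 0`. The other chart is treated likewise.
    by_cases h1 : ![1, 0] ∈ S <;> by_cases h2 : ![0, 1] ∈ S
    · refine fin ![-1, 0] ?_ ?_ ?_ ?_ <;> norm_num [totPolyhedron, h1, h2]
    · refine fin ![-1, 1] ?_ ?_ ?_ ?_ <;> norm_num [totPolyhedron, h1, h2]
    · refine fin ![0, 0] ?_ ?_ ?_ ?_ <;> norm_num [totPolyhedron, h1, h2]
    · refine fin ![0, 1] ?_ ?_ ?_ ?_ <;> norm_num [totPolyhedron, h1, h2]
  · have fin : ∀ p ∈ totPolyhedron, 0 ≤ p 0 → (-p 0 + 2 * p 1 = -1 ↔ ![-1, 2] ∈ S) →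
        (p 1 = 0 ↔ ![0, 1] ∈ S) →
        _ := fun p hp h0 h1 h2 => key p hp (normalCone_le_chartCone_true hp h0) (by
      have := toReal_mem_normalCone_totPolyhedron hp
      intro g hg
      simp only [totGens, Finset.mem_insert, Finset.mem_singleton] at hg
      rcases hg with rfl | rfl
      · exact this.2.2.trans h1
      · exact this.2.1.trans h2)
    by_cases h1 : ![-1, 2] ∈ S <;> by_cases h2 : ![0, 1] ∈ S
    · refine fin ![1, 0] ?_ ?_ ?_ ?_ <;> norm_num [totPolyhedron, h1, h2]
    · refine fin ![3, 1] ?_ ?_ ?_ ?_ <;> norm_num [totPolyhedron, h1, h2]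
    · refine fin ![0, 0] ?_ ?_ ?_ ?_ <;> norm_num [totPolyhedron, h1, h2]
    · refine fin ![0, 1] ?_ ?_ ?_ ?_ <;> norm_num [totPolyhedron, h1, h2]

/-- Faces of a chart cone are determined by the generators they contain, and every subset of
generators is realised by the normal cone at some point. Conversely, the sign of `p 0` places each
normal cone inside a chart cone, of which it is then a face. -/
theorem totFan_two_cones :
    (totFan 2).cones = {σ | ∃ p ∈ totPolyhedron, σ = normalCone totPolyhedron p} := by
  classical
  ext τ
  constructor
  · rintro ⟨b, hτ⟩
    obtain ⟨p, hp, hle, h⟩ := exists_face_point b ((totGens 2 b).filter fun g => toReal g ∈ τ)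
    refine ⟨p, hp, ?_⟩
    rw [face_eq_hull 2 b hτ, face_eq_hull 2 b (normalCone_isFaceOf_chartCone hp b hle)]
    congr 2
    ext g
    simp only [Set.mem_ofPred_eq]
    refine and_congr_right fun hg => ?_
    rw [h g hg, Finset.mem_filter, and_iff_right hg]
  · rintro ⟨p, hp, rfl⟩
    rcases le_total (p 0) 0 with h | h
    · exact ⟨false, normalCone_isFaceOf_chartCone hp _ (normalCone_le_chartCone_false hp h)⟩
    · exact ⟨true, normalCone_isFaceOf_chartCone hp _ (normalCone_le_chartCone_true hp h)⟩

/-! ### The self-dual model of degree two -/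

/-- The preferred lift to `ℂ` of the class in `ℂ/ℤ` of a coefficient. -/
def logCoeff {ι : Type} (W : AddMonoidAlgebra ℂ (ι → ℤ)) (ξ : ι → ℤ) : ℂ :=
  Complex.log (W.coeff ξ) / (2 * Real.pi * Complex.I)

theorem exp_logCoeff {ι : Type} {W : AddMonoidAlgebra ℂ (ι → ℤ)} {ξ : ι → ℤ}
    (h : ξ ∈ W.coeff.support) :
    Complex.exp (2 * Real.pi * Complex.I * logCoeff W ξ) = W.coeff ξ := by
  rw [logCoeff, mul_div_cancel₀ _ Complex.two_pi_I_ne_zero,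
    Complex.exp_log (Finsupp.mem_support_iff.1 h)]

theorem eq_sum_exp_logCoeff {ι r : Type} [Fintype r] (W : AddMonoidAlgebra ℂ (ι → ℤ))
    (σ : r ≃ W.coeff.support) :
    W = ∑ i, AddMonoidAlgebra.single (σ i).1
      (Complex.exp (2 * Real.pi * Complex.I * logCoeff W (σ i).1)) := by
  rw [Equiv.sum_comp σ fun ξ => AddMonoidAlgebra.single ξ.1
      (Complex.exp (2 * Real.pi * Complex.I * logCoeff W ξ.1))]
  rw [Finset.sum_congr rfl fun ξ _ => by rw [exp_logCoeff ξ.2]]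
  rw [Finset.sum_coe_sort W.coeff.support fun ξ => AddMonoidAlgebra.single ξ (W.coeff ξ)]
  apply AddMonoidAlgebra.coeff_injective
  rw [AddMonoidAlgebra.coeff_sum]
  exact (Finsupp.sum_single W.coeff).symm

instance Fan.fintypeRays {ι : Type} [Fintype ι] (F : Fan ι) : Fintype (rays F.cones) :=
  Fintype.ofFinite _

/-- The coefficients of the superpotential of the self-dual model. -/
def selfDualCoeff : Fin 3 → ℂ :=
  -- Since `e^{-2π} = e^{2πi·i}`, the lifts are `i, 0, i`, with the constants `1, 0, 1` of
  -- `totPolyhedron` as imaginary parts.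
  ![(Real.exp (-(2 * Real.pi)) : ℝ), 1, (Real.exp (-(2 * Real.pi)) : ℝ)]

/-- The superpotential of the self-dual model. -/
def selfDualPotential : AddMonoidAlgebra ℂ (Fin 2 → ℤ) := sectionPotential 2 selfDualCoeff

theorem coeff_selfDualPotential (ξ : Fin 2 → ℤ) : selfDualPotential.coeff ξ =
    if ξ = ![0, 1] ∨ ξ = ![2, 1] then ((Real.exp (-(2 * Real.pi)) : ℝ) : ℂ)
    else if ξ = ![1, 1] then 1 else 0 := by
  rw [selfDualPotential, sectionPotential, AddMonoidAlgebra.coeff_sum, Finset.sum_apply']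
  refine (Fin.sum_univ_three _).trans ?_
  simp only [AddMonoidAlgebra.coeff_single, Finsupp.single_apply, selfDualCoeff, eq_comm (b := ξ)]
  by_cases h0 : ξ = ![0, 1]
  · simp [h0]
  by_cases h1 : ξ = ![1, 1]
  · simp [h1]
  by_cases h2 : ξ = ![2, 1]
  · simp [h2]
  simp [h0, h1, h2]

theorem mem_support_selfDualPotential {ξ : Fin 2 → ℤ} :
    ξ ∈ selfDualPotential.coeff.support ↔ ξ = ![0, 1] ∨ ξ = ![1, 1] ∨ ξ = ![2, 1] := by
  rw [Finsupp.mem_support_iff, coeff_selfDualPotential]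
  by_cases h0 : ξ = ![0, 1]
  · simp [h0]
  by_cases h1 : ξ = ![1, 1]
  · simp [h1]
  by_cases h2 : ξ = ![2, 1]
  · simp [h2]
  simp [h0, h1, h2]

theorem logCoeff_selfDualPotential_im (ξ : Fin 2 → ℤ) : (logCoeff selfDualPotential ξ).im =
    if ξ = ![0, 1] ∨ ξ = ![2, 1] then 1 else 0 := by
  rw [logCoeff, coeff_selfDualPotential]
  -- Off the support the coefficient is `0` and `Complex.log 0 = 0`, so the formula holds for every
  -- `ξ`.
  split_ifs
  · have : (2 * Real.pi * Complex.I : ℂ) ≠ 0 := Complex.two_pi_I_ne_zero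
    have e : Complex.log ((Real.exp (-(2 * Real.pi)) : ℝ) : ℂ) / (2 * Real.pi * Complex.I) =
        Complex.I := by
      rw [← Complex.ofReal_log (Real.exp_pos _).le, Real.log_exp, div_eq_iff this]
      push_cast
      linear_combination (-(2 * Real.pi) : ℂ) * Complex.I_mul_I
    rw [e, Complex.I_im]
  · simp
  · simp

/-- The automorphism of the lattice which identifies the exponents `(i, 1)`, `0 ≤ i ≤ 2`, with the
images of the primitive ray generators of `Tot(O_{ℙ¹}(-2))`. -/
def mirrorMap : Matrix.GeneralLinearGroup (Fin 2) ℤ where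
  -- The rays `(1,0)`, `(0,1)`, `(-1,2)` go to `(0,1)`, `(1,1)`, `(2,1)`. The matrix is symmetric,
  -- so it acts in the same way on characters and on one-parameter subgroups.
  val := !![0, 1; 1, 1]
  inv := !![-1, 1; 1, 0]
  val_inv := by decide
  inv_val := by decide

theorem mirrorMap_mulVec (v : Fin 2 → ℤ) : mirrorMap.1.mulVec v = ![v 1, v 0 + v 1] := by
  funext j
  fin_cases j <;> simp [mirrorMap, Matrix.mulVec, dotProduct, Fin.sum_univ_two]

theorem mirrorMap_inv_mulVec (v : Fin 2 → ℤ) :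
    (mirrorMap⁻¹).1.mulVec v = ![v 1 - v 0, v 0] := by
  have : (mirrorMap⁻¹).1 = !![-1, 1; 1, 0] := rfl
  rw [this]
  funext j
  fin_cases j <;> simp [Matrix.mulVec, dotProduct, Fin.sum_univ_two]
  ring

theorem mirrorMap_inv_transpose : (mirrorMap⁻¹).1.transpose = (mirrorMap⁻¹).1 := by
  have : (mirrorMap⁻¹).1 = !![-1, 1; 1, 0] := rfl
  rw [this]
  decide

theorem realMap_mirrorMap (x : Fin 2 → ℝ) : realMap mirrorMap x = ![x 1, x 0 + x 1] := by
  funext j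
  fin_cases j <;> simp [mirrorMap, Matrix.mulVec, dotProduct, Fin.sum_univ_two]

/-! ### Rays and monomials under the mirror map -/

theorem mem_rays_totFan_two {v : Fin 2 → ℤ} :
    v ∈ rays (totFan 2).cones ↔ v = ![1, 0] ∨ v = ![0, 1] ∨ v = ![-1, 2] := by
  exact_mod_cast mem_rays_totFan (k := 2)

theorem mem_rays_mirror {v : Fin 2 → ℤ} :
    v ∈ rays ((totFan 2).map mirrorMap).cones ↔ v ∈ selfDualPotential.coeff.support := by
  have e : v = mirrorMap.1.mulVec ![v 1 - v 0, v 0] := by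
    rw [mirrorMap_mulVec]
    funext j; fin_cases j <;> simp
  have h : ∀ a b : ℤ, v = ![a, b] ↔ v 0 = a ∧ v 1 = b := by
    intro a b
    rw [funext_iff, Fin.forall_fin_two]
    rfl
  have h' : ∀ a b c d : ℤ, ![a, b] = ![c, d] ↔ a = c ∧ b = d := by
    intro a b c d
    rw [funext_iff, Fin.forall_fin_two]
    rfl
  rw [mem_support_selfDualPotential, h, h, h]
  rw [e, mulVec_mem_rays_map, mem_rays_totFan_two, h', h', h', ← e]
  omega

/-- The superpotential of the dual. -/
def mirrorPotential : AddMonoidAlgebra ℂ (Fin 2 → ℤ) :=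
  AddMonoidAlgebra.mapDomain (fun ξ => (mirrorMap⁻¹).1.transpose.mulVec ξ) selfDualPotential

theorem coeff_mirrorPotential (v : Fin 2 → ℤ) :
    mirrorPotential.coeff v = selfDualPotential.coeff ![v 1, v 0 + v 1] := by
  have hv : v = (fun ξ => (mirrorMap⁻¹).1.transpose.mulVec ξ) ![v 1, v 0 + v 1] := by
    simp only [mirrorMap_inv_transpose, mirrorMap_inv_mulVec]
    funext j; fin_cases j <;> simp
  rw [mirrorPotential, AddMonoidAlgebra.coeff_mapDomain]
  conv_lhs => rw [hv]
  refine Finsupp.mapDomain_apply ?_ _ _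
  intro x y hxy
  simp only [mirrorMap_inv_transpose, mirrorMap_inv_mulVec] at hxy
  have h0 := congrFun hxy 0
  have h1 := congrFun hxy 1
  simp at h0 h1
  funext j
  fin_cases j
  · exact h1
  · simp
    omega

theorem logCoeff_mirrorPotential (v : Fin 2 → ℤ) :
    logCoeff mirrorPotential v = logCoeff selfDualPotential ![v 1, v 0 + v 1] := by
  rw [logCoeff, coeff_mirrorPotential, logCoeff]

theorem mem_support_mirrorPotential {v : Fin 2 → ℤ} :
    v ∈ mirrorPotential.coeff.support ↔ v ∈ rays (totFan 2).cones := by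
  rw [Finsupp.mem_support_iff, coeff_mirrorPotential, ← Finsupp.mem_support_iff,
    ← mem_rays_mirror, ← mirrorMap_mulVec, mulVec_mem_rays_map]

theorem logCoeff_mirrorPotential_im (v : Fin 2 → ℤ) : (logCoeff mirrorPotential v).im =
    if v = ![1, 0] ∨ v = ![-1, 2] then 1 else 0 := by
  rw [logCoeff_mirrorPotential, logCoeff_selfDualPotential_im]
  have h' : ∀ a b c d : ℤ, ![a, b] = ![c, d] ↔ a = c ∧ b = d := by
    intro a b c d
    rw [funext_iff, Fin.forall_fin_two]
    rfl
  have h : ∀ a b : ℤ, v = ![a, b] ↔ v 0 = a ∧ v 1 = b := by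
    intro a b
    rw [funext_iff, Fin.forall_fin_two]
    rfl
  congr 1
  rw [h', h', h, h, eq_iff_iff]
  omega

theorem selfDualPotential_regular {ξ : Fin 2 → ℤ} (hξ : ξ ∈ selfDualPotential.coeff.support)
    {σ : PointedCone ℝ (Fin 2 → ℝ)} (hσ : σ ∈ (totFan 2).cones) {v : Fin 2 → ℝ} (hv : v ∈ σ) :
    0 ≤ toReal ξ ⬝ᵥ v := by
  obtain ⟨b, hb⟩ := hσ
  have h := hb.le hv
  rw [mem_support_selfDualPotential] at hξ
  cases b <;> simp only [mem_totChart_false, mem_totChart_true] at h <;>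
    rcases hξ with rfl | rfl | rfl <;> simp [toReal, dotProduct, Fin.sum_univ_two] <;>
    push_cast at h <;> linarith [h.1, h.2]

/-- The self-dual model on `Tot(O_{ℙ¹}(-2))`. -/
def selfDualModel : ToricLG (Fin 2) where
  fan := totFan 2
  W := selfDualPotential
  regular _ hξ _ hσ _ hv := selfDualPotential_regular hξ hσ hv
  -- The dual takes its superpotential from `(dv, K)`, so `K` has to be the class of the
  -- coefficients of `mirrorPotential`, whose monomials are the rays.
  K := tensorClass _ fun v => ((logCoeff mirrorPotential v.1 : ℂ) : CmodZ)

/-- The dual of the self-dual model. -/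
def mirrorModel : ToricLG (Fin 2) where
  fan := (totFan 2).map mirrorMap
  W := mirrorPotential
  regular := by
    rintro ξ hξ _ ⟨σ, hσ, rfl⟩ _ ⟨v, hv, rfl⟩
    rw [mem_support_mirrorPotential, ← mulVec_mem_rays_map mirrorMap, mem_rays_mirror] at hξ
    have := selfDualPotential_regular hξ hσ hv
    rw [mirrorMap_mulVec] at this
    change 0 ≤ toReal ξ ⬝ᵥ realMap mirrorMap v
    rw [realMap_mirrorMap]
    simp [toReal, dotProduct, Fin.sum_univ_two] at this ⊢
    linarith
  K := tensorClass _ fun v => ((logCoeff selfDualPotential v.1 : ℂ) : CmodZ)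

/-! ### Normal fans of the two linear data -/

theorem dv_mul_mon_nonneg (v : rays (totFan 2).cones) (ξ : selfDualPotential.coeff.support) :
    0 ≤ v.1 ⬝ᵥ ξ.1 := by
  obtain ⟨v, hv⟩ := v
  obtain ⟨ξ, hξ⟩ := ξ
  rw [mem_rays_totFan_two] at hv
  rw [mem_support_selfDualPotential] at hξ
  rcases hv with rfl | rfl | rfl <;> rcases hξ with rfl | rfl | rfl <;>
    simp [dotProduct, Fin.sum_univ_two]

theorem polyhedron_dvDatum :
    polyhedron selfDualModel.dvDatum.mat
      (fun v : rays (totFan 2).cones => (logCoeff mirrorPotential v.1).im) = totPolyhedron := by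
  ext m
  have e : m ∈ polyhedron selfDualModel.dvDatum.mat
      (fun v : rays (totFan 2).cones => (logCoeff mirrorPotential v.1).im) ↔
      ∀ v ∈ rays (totFan 2).cones, 0 ≤ toReal v ⬝ᵥ m + (logCoeff mirrorPotential v).im :=
    ⟨fun h v hv => h ⟨v, hv⟩, fun h v => h v.1 v.2⟩
  rw [e]
  simp only [mem_rays_totFan_two, forall_eq_or_imp, forall_eq, logCoeff_mirrorPotential_im]
  simp [toReal, dotProduct, Fin.sum_univ_two, totPolyhedron]

/-- The rows are the vectors `G v` for the rays `v`, with the same constants, and `⟨G v, n⟩ = ⟨v, G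
n⟩` by symmetry of `G = mirrorMap`. -/
theorem polyhedron_monDatum :
    polyhedron selfDualModel.monDatum.mat
      (fun ξ : selfDualPotential.coeff.support => (logCoeff selfDualPotential ξ.1).im) =
      realMap mirrorMap ⁻¹' totPolyhedron := by
  ext n
  have e : n ∈ polyhedron selfDualModel.monDatum.mat
      (fun ξ : selfDualPotential.coeff.support => (logCoeff selfDualPotential ξ.1).im) ↔
      ∀ ξ ∈ selfDualPotential.coeff.support,
        0 ≤ toReal ξ ⬝ᵥ n + (logCoeff selfDualPotential ξ).im :=
    ⟨fun h v hv => h ⟨v, hv⟩, fun h v => h v.1 v.2⟩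
  rw [e, Set.mem_preimage, realMap_mirrorMap]
  simp only [mem_support_selfDualPotential, forall_eq_or_imp, forall_eq,
    logCoeff_selfDualPotential_im]
  simp [toReal, dotProduct, Fin.sum_univ_two, totPolyhedron]
  intros
  constructor <;> intro <;> linarith

theorem polyhedralCones_of_polyhedron_eq {ι r : Type} [Fintype ι] {C : Matrix r ι ℤ} {c : r → ℝ}
    {P : Set (ι → ℝ)} (h : polyhedron C c = P) :
    polyhedralCones C c = {σ | ∃ p ∈ P, σ = normalCone P p} := by
  subst h
  rfl

theorem polyhedralCones_dvDatum :
    polyhedralCones selfDualModel.dvDatum.mat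
      (fun v : rays (totFan 2).cones => (logCoeff mirrorPotential v.1).im) =
      (totFan 2).cones :=
  (polyhedralCones_of_polyhedron_eq polyhedron_dvDatum).trans totFan_two_cones.symm

theorem polyhedralCones_monDatum :
    polyhedralCones selfDualModel.monDatum.mat
      (fun ξ : selfDualPotential.coeff.support => (logCoeff selfDualPotential ξ.1).im) =
      ((totFan 2).map mirrorMap).cones := by
  have hT : mirrorMap.1.transpose = mirrorMap.1 := by decide
  have e : ((totFan 2).map mirrorMap).cones =
      PointedCone.map (realMap mirrorMap) '' (totFan 2).cones := rfl
  rw [e, totFan_two_cones]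
  refine (polyhedralCones_of_polyhedron_eq polyhedron_monDatum).trans ?_
  ext τ
  constructor
  · rintro ⟨p, hp, rfl⟩
    exact ⟨_, ⟨_, hp, rfl⟩, (map_normalCone _ hT _ _).symm⟩
  · rintro ⟨_, ⟨p, hp, rfl⟩, rfl⟩
    obtain ⟨q, rfl⟩ := realMap_surjective mirrorMap p
    exact ⟨q, hp, (map_normalCone _ hT _ _).symm⟩

/-- The rays of the dual are the monomials of the superpotential. -/
def mirrorRaysEquiv : rays mirrorModel.fan.cones ≃ selfDualPotential.coeff.support :=
  Equiv.subtypeEquivRight fun _ => mem_rays_mirror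

/-- The rays of the self-dual model are the monomials of the superpotential of the dual. -/
def raysEquiv : rays selfDualModel.fan.cones ≃ mirrorPotential.coeff.support :=
  Equiv.subtypeEquivRight fun _ => mem_support_mirrorPotential.symm

/-! ### Self-duality of the model of degree two -/

theorem isKopasepticReal_dvDatum :
    IsKopasepticReal selfDualModel.dvDatum.mat
      (fun v : rays (totFan 2).cones => (logCoeff mirrorPotential v.1).im) := by
  constructor
  · have : Finite selfDualModel.dvDatum.r := inferInstance
    refine interior_polyhedron_nonempty (ξ := ![0, 1]) ?_
    rintro ⟨v, hv⟩
    change 0 < toReal v ⬝ᵥ _ + (logCoeff mirrorPotential v).im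
    rw [logCoeff_mirrorPotential_im]
    rcases mem_rays_totFan_two.1 hv with rfl | rfl | rfl <;>
      norm_num [toReal, dotProduct, Fin.sum_univ_two]
  · rw [polyhedralCones_dvDatum]
    exact ⟨_, isReduction_of_equiv (Equiv.refl _) fun _ => rfl⟩

theorem isKopasepticReal_monDatum :
    IsKopasepticReal selfDualModel.monDatum.mat
      (fun ξ : selfDualPotential.coeff.support => (logCoeff selfDualPotential ξ.1).im) := by
  constructor
  · have : Finite selfDualModel.monDatum.r := inferInstance
    refine interior_polyhedron_nonempty (ξ := ![0, 1]) ?_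
    rintro ⟨ξ, hξ⟩
    change 0 < toReal ξ ⬝ᵥ _ + (logCoeff selfDualPotential ξ).im
    rw [logCoeff_selfDualPotential_im]
    rcases mem_support_selfDualPotential.1 hξ with rfl | rfl | rfl <;>
      norm_num [toReal, dotProduct, Fin.sum_univ_two]
  · rw [polyhedralCones_monDatum]
    exact ⟨_, isReduction_of_equiv mirrorRaysEquiv fun _ => rfl⟩

theorem isModelOf_selfDualModel :
    IsModelOf selfDualModel.dvDatum selfDualModel.monDatum selfDualModel := by
  refine ⟨⟨_, (imClass_tensorClass selfDualModel.dvDatum.mat fun v : rays (totFan 2).cones =>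
    logCoeff mirrorPotential v.1).symm, isKopasepticReal_dvDatum,
    polyhedralCones_dvDatum.symm⟩, dv_mul_mon_nonneg, ⟨_, isReduction_of_equiv (Equiv.refl _)
    fun _ => rfl, ?_⟩, ⟨_, rfl, eq_sum_exp_logCoeff selfDualPotential (Equiv.refl _)⟩⟩
  exact (cokerMap_tensorClass selfDualModel.dvDatum.mat (dv selfDualModel.fan.cones)
    (Equiv.refl (rays (totFan 2).cones)) _ _
    fun v : rays (totFan 2).cones => ((logCoeff mirrorPotential v.1 : ℂ) : CmodZ)).symm

/-- The rays of `mirrorModel` are the monomials of the original superpotential and its monomials are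
the original rays. The same logarithms of coefficients therefore serve as lifts on both sides. -/
theorem isDual_mirrorModel : IsDual selfDualModel mirrorModel := by
  refine ⟨⟨_, (imClass_tensorClass selfDualModel.monDatum.mat
    fun ξ : selfDualPotential.coeff.support => logCoeff selfDualPotential ξ.1).symm,
    isKopasepticReal_monDatum,
    polyhedralCones_monDatum.symm⟩, fun ξ v => ?_, ⟨_, isReduction_of_equiv mirrorRaysEquiv
    fun _ => rfl, ?_⟩, ⟨_, rfl, eq_sum_exp_logCoeff mirrorPotential raysEquiv⟩⟩
  · refine (dv_mul_mon_nonneg v ξ).trans_eq ?_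
    exact dotProduct_comm _ _
  · exact (cokerMap_tensorClass selfDualModel.monDatum.mat (dv mirrorModel.fan.cones)
      mirrorRaysEquiv _ _ fun ξ : selfDualPotential.coeff.support =>
        ((logCoeff selfDualPotential ξ.1 : ℂ) : CmodZ)).symm

/-- The bijection of rays induced by the isomorphism of the dual with the self-dual model. -/
def isoRaysEquiv : rays mirrorModel.fan.cones ≃ rays selfDualModel.fan.cones where
  toFun v := ⟨(mirrorMap⁻¹).1.mulVec v.1, by
    rw [← mulVec_mem_rays_map mirrorMap, Matrix.mulVec_mulVec, ← Units.val_mul, mul_inv_cancel,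
      Units.val_one, Matrix.one_mulVec]
    exact v.2⟩
  invFun v := ⟨mirrorMap.1.mulVec v.1, (mulVec_mem_rays_map mirrorMap).2 v.2⟩
  left_inv v := Subtype.ext <| by
    simp only [Matrix.mulVec_mulVec, ← Units.val_mul, mul_inv_cancel, Units.val_one,
      Matrix.one_mulVec]
  right_inv v := Subtype.ext <| by
    simp only [Matrix.mulVec_mulVec, ← Units.val_mul, inv_mul_cancel, Units.val_one,
      Matrix.one_mulVec]

theorem isIso_mirrorModel : IsIso mirrorModel selfDualModel := by
  refine ⟨mirrorMap⁻¹, ?_, rfl, isoRaysEquiv, fun _ => rfl, ?_, ?_⟩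
  · change (totFan 2).cones =
      PointedCone.map (realMap mirrorMap⁻¹) '' (PointedCone.map (realMap mirrorMap) '' _)
    rw [Set.image_image]
    simp only [PointedCone.map_map, realMap_comp, inv_mul_cancel, realMap_one,
      PointedCone.map_id, Set.image_id']
  · refine LinearMap.ext fun x => funext fun v => ?_
    change (mirrorMap⁻¹).1.mulVec v.1 ⬝ᵥ x = v.1 ⬝ᵥ (mirrorMap⁻¹).1.transpose.mulVec x
    rw [Matrix.dotProduct_mulVec, Matrix.vecMul_transpose]
  · refine Eq.trans ?_ (cokerMap_tensorClass _ _ isoRaysEquiv _ _ _).symm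
    change tensorClass _ _ = tensorClass _ _
    congr 1
    funext v
    -- The classes agree already on representatives: the coefficient of the dual's superpotential at
    -- the image of the ray `v` is that of the original one at `v`.
    have e : ((isoRaysEquiv v).1) = ![v.1 1 - v.1 0, v.1 0] := mirrorMap_inv_mulVec v.1
    change ((logCoeff selfDualPotential v.1 : ℂ) : CmodZ) =
      ((logCoeff mirrorPotential (isoRaysEquiv v).1 : ℂ) : CmodZ)
    rw [e, logCoeff_mirrorPotential]
    congr 2
    funext j
    fin_cases j <;> simp

theorem isSelfDual_selfDualModel : IsSelfDual selfDualModel :=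
  ⟨isModelOf_selfDualModel, mirrorModel, isDual_mirrorModel, isIso_mirrorModel⟩

end ToricLandauGinzburg

end

theorem mainTheorem2 (k : ℕ) :
    (∃ X : ToricLandauGinzburg.ToricLG (Fin 2), X.fan = ToricLandauGinzburg.totFan k ∧
      (∃ a : Fin (k + 1) → ℂ, X.W = ToricLandauGinzburg.sectionPotential k a) ∧
      ToricLandauGinzburg.IsSelfDual X) ↔ k = 2 := by
  constructor
  · rintro ⟨X, hfan, ⟨a, hW⟩, hX⟩
    exact ToricLandauGinzburg.eq_two_of_isSelfDual hfan hW hX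
  · rintro rfl
    exact ⟨ToricLandauGinzburg.selfDualModel, rfl, ⟨_, rfl⟩,
      ToricLandauGinzburg.isSelfDual_selfDualModel⟩
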